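/- All graphs are finite and simple. For a graph $G$ write $e(G)=|E(G)|$ and let $\delta(G)$ be its minimum degree. A set $S\subseteq E(G)$ is an edge-cut if $G-S$ is disconnected, and the edge-connectivity $\lambda(G)$ is the minimum cardinality of an edge-cut; $G$ is maximally edge-connected if $\lambda(G)=\delta(G)$. An edge-cut $S$ is a 3-restricted edge-cut if every component of $G-S$ has at least three vertices; $\lambda_3(G)$ is the minimum cardinality of a 3-restricted edge-cut of $G$ if one exists, and $\lambda_3(G)=+\infty$ otherwise. The strong product $G\boxtimes H$ has vertex set $V(G)\times V(H)$, and $(x_1,y_1)$, $(x_2,y_2)$ are adjacent if and only if $x_1=x_2$ and $y_1y_2\in E(H)$, or $y_1=y_2$ and $x_1x_2\in E(G)$, or $x_1x_2\in E(G)$ and $y_1y_2\in E(H)$. $K_n$ is the complete graph of order $n$. Theorem 3.2. Let $G$ be a maximally edge-connected graph of order $m\ge 3$, and let $n\ge 4$. Then $$\lambda_3(G\boxtimes K_n)=\min\{\,n^2\delta(G),\ (n-1)(m+2e(G)),\ 3n\delta(G)+3n-9\,\}.$$ -/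

import Mathlib

namespace RestrictedEdgeConnectivity

/-- The strong product `G ⊠ H`: two vertices `(x₁, y₁)` and `(x₂, y₂)` are adjacent iff
`x₁ = x₂` and `y₁y₂ ∈ E(H)`, or `y₁ = y₂` and `x₁x₂ ∈ E(G)`, or `x₁x₂ ∈ E(G)` and
`y₁y₂ ∈ E(H)`. -/
def strongProd {α β : Type*} (G : SimpleGraph α) (H : SimpleGraph β) :
    SimpleGraph (α × β) where
  Adj p q :=
    (p.1 = q.1 ∧ H.Adj p.2 q.2) ∨ (p.2 = q.2 ∧ G.Adj p.1 q.1) ∨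
      (G.Adj p.1 q.1 ∧ H.Adj p.2 q.2)
  symm := ⟨by
    rintro p q (⟨h, h'⟩ | ⟨h, h'⟩ | ⟨h, h'⟩)
    · exact Or.inl ⟨h.symm, h'.symm⟩
    · exact Or.inr (Or.inl ⟨h.symm, h'.symm⟩)
    · exact Or.inr (Or.inr ⟨h.symm, h'.symm⟩)⟩
  loopless := ⟨by
    rintro p (⟨_, h⟩ | ⟨_, h⟩ | ⟨h, _⟩)
    · exact H.loopless.irrefl _ h
    · exact G.loopless.irrefl _ h
    · exact G.loopless.irrefl _ h⟩

/-- `S ⊆ E(G)` is an edge-cut if `G - S` is disconnected, that is, some two vertices are not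
joined by a path of `G - S`. -/
def IsEdgeCut {V : Type*} (G : SimpleGraph V) (S : Set (Sym2 V)) : Prop :=
  S ⊆ G.edgeSet ∧ ¬ (G.deleteEdges S).Preconnected

/-- The edge-connectivity `λ(G)`: the minimum cardinality of an edge-cut
(`⊤` if there is none, which for finite graphs happens only on at most one vertex). -/
noncomputable def edgeConnectivity {V : Type*} (G : SimpleGraph V) : ℕ∞ :=
  sInf (Set.encard '' {S : Set (Sym2 V) | IsEdgeCut G S})

/-- `G` is maximally edge-connected if `λ(G) = δ(G)`. -/
def IsMaximallyEdgeConnected {V : Type*} [Fintype V] (G : SimpleGraph V)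
    [DecidableRel G.Adj] : Prop :=
  edgeConnectivity G = (G.minDegree : ℕ∞)

/-- `S ⊆ E(G)` is a `k`-restricted edge-cut if `G - S` is disconnected and every component of
`G - S` has at least `k` vertices. -/
def IsRestrictedEdgeCut {V : Type*} (k : ℕ) (G : SimpleGraph V) (S : Set (Sym2 V)) : Prop :=
  IsEdgeCut G S ∧
    ∀ C : (G.deleteEdges S).ConnectedComponent, (k : ℕ∞) ≤ C.supp.encard

/-- The `k`-restricted edge-connectivity `λ_k(G)`: the minimum cardinality of a `k`-restricted
edge-cut, and `+∞` if there is none. -/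
noncomputable def restrictedEdgeConnectivity {V : Type*} (k : ℕ) (G : SimpleGraph V) : ℕ∞ :=
  sInf (Set.encard '' {S : Set (Sym2 V) | IsRestrictedEdgeCut k G S})

end RestrictedEdgeConnectivity

/-!
Let `A` be a set of vertices of `G ⊠ Kₙ` and let `a x` be the number of its vertices in the fibre
over `x`. The size of the boundary of `A` depends only on `a`: it is
`∑ x, a x * (n - a x) + ∑ x, ∑ y ~ x, a x * (n - a y)`, called `fibreCut G n a` below. A 3-restricted
edge-cut contains the boundary of each component it leaves, so the lower bound is a statement about
`fibreCut` for functions `a ≤ n` such that `a` and `n - a` both have sum at least `3`.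

If `δ(G) = 0` the minimum is `0`, attained at a fibre over an isolated vertex. Let `δ = δ(G) > 0`.

* If `1 ≤ a ≤ n - 1` everywhere, each vertex of `G` contributes at least `n - 1` and each edge at
  least `2(n - 1)` (`le_fibreCut_of_pos_of_lt`).
* If `a` vanishes somewhere and `a w ≥ 3` for some `w`, the edge terms dominate `n` times the total
  variation of `a`. Each of the level sets `{a > t}`, `t < a w`, is nonempty and proper, so has at
  least `λ(G) = δ` boundary edges, whence a total of at least `n δ a(w) + a(w) (n - a(w))`
  (`IsMaximallyEdgeConnected.mul_le_fibreCut`). Using `δ ≥ 1`, this is smallest at `a w = 3`.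
* If `a ≤ 2`, let `s = ∑ a` and `N = n (1 + δ)`. All degrees in `G ⊠ Kₙ` are at least `N - 1`, so the
  boundary has at least `s (N - s)` edges, which suffices for `s ≤ 5`; it also has at least
  `s (n - 2) (1 + δ)` edges, which suffices for `s ≥ 6`.
* If `a = n` somewhere, replace `A` by its complement.

The three values are attained by a whole fibre, by a copy of `G`, and by three vertices in the fibre
over a vertex of minimum degree.
-/

namespace RestrictedEdgeConnectivity

open Finset

/-! ### Boundaries and edge-cuts -/

section Cuts

variable {V : Type*} [Fintype V] [DecidableEq V]

/-- The set of edges of `G` with exactly one end in `X`. -/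
def boundary {V : Type*} (G : SimpleGraph V) (X : Set V) : Set (Sym2 V) :=
  {e | ∃ x ∈ X, ∃ y ∉ X, G.Adj x y ∧ e = s(x, y)}

lemma encard_boundary_le (G : SimpleGraph V) [DecidableRel G.Adj] (X : Finset V) :
    (boundary G X).encard ≤ (G.interedges X Xᶜ).card := by
  have h : boundary G X ⊆ (fun p : V × V => s(p.1, p.2)) '' (G.interedges X Xᶜ : Set (V × V)) := by
    rintro e ⟨x, hx, y, hy, hxy, rfl⟩
    refine ⟨(x, y), ?_, rfl⟩
    simpa [SimpleGraph.mem_interedges_iff, hxy] using And.intro hx hy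
  calc _ ≤ _ := Set.encard_le_encard h
    _ ≤ _ := Set.encard_image_le _ _
    _ = _ := Set.encard_coe_eq_coe_finsetCard _

lemma boundary_adj_iff {V : Type*} (G : SimpleGraph V) (X : Set V) {x y : V} :
    (G.deleteEdges (boundary G X)).Adj x y ↔ G.Adj x y ∧ (x ∈ X ↔ y ∈ X) := by
  rw [SimpleGraph.deleteEdges_adj]
  refine and_congr_right fun h => ?_
  constructor
  · intro hn
    by_contra hc
    apply hn
    by_cases hx : x ∈ X
    · exact ⟨x, hx, y, by tauto, h, rfl⟩
    · exact ⟨y, by tauto, x, hx, h.symm, Sym2.eq_swap⟩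
  · rintro hxy ⟨u, hu, v, hv, -, he⟩
    rcases Sym2.eq_iff.1 he with ⟨rfl, rfl⟩ | ⟨rfl, rfl⟩ <;> tauto

lemma boundary_reachable {V : Type*} (G : SimpleGraph V) (X : Set V) {x y : V}
    (h : (G.deleteEdges (boundary G X)).Reachable x y) : x ∈ X ↔ y ∈ X := by
  obtain ⟨w⟩ := h
  induction w with
  | nil => rfl
  | cons h _ ih => exact ((boundary_adj_iff G X).1 h).2.trans ih

lemma isEdgeCut_boundary {V : Type*} (G : SimpleGraph V) {X : Set V} {x y : V} (hx : x ∈ X)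
    (hy : y ∉ X) : IsEdgeCut G (boundary G X) := by
  refine ⟨?_, fun h => hy ((boundary_reachable G X (h x y)).1 hx)⟩
  rintro e ⟨x, -, y, -, h, rfl⟩
  exact h

/-- A nonempty proper vertex set of a maximally edge-connected graph has at least `δ(G)` boundary
edges. -/
lemma IsMaximallyEdgeConnected.minDegree_le_card_interedges {G : SimpleGraph V}
    [DecidableRel G.Adj] (hG : IsMaximallyEdgeConnected G) {X : Finset V} {x y : V}
    (hx : x ∈ X) (hy : y ∉ X) : G.minDegree ≤ (G.interedges X Xᶜ).card := by
  have h : (G.minDegree : ℕ∞) ≤ (G.interedges X Xᶜ).card := by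
    rw [← hG]
    refine le_trans (b := (boundary G X).encard) (sInf_le ?_) (encard_boundary_le G X)
    exact ⟨_, isEdgeCut_boundary G (mem_coe.2 hx) (by simpa using hy), rfl⟩
  exact_mod_cast h

lemma IsMaximallyEdgeConnected.preconnected {G : SimpleGraph V}
    [DecidableRel G.Adj] (hG : IsMaximallyEdgeConnected G) (hδ : 0 < G.minDegree) :
    G.Preconnected := by
  by_contra hc
  have h : edgeConnectivity G ≤ 0 := by
    refine sInf_le ⟨∅, ⟨Set.empty_subset _, by simpa using hc⟩, by simp⟩
  rw [hG] at h
  norm_cast at h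
  omega

/-- A restricted edge-cut contains the whole boundary of a vertex set which, like its complement,
is large: any component left by the cut is such a set. -/
lemma IsRestrictedEdgeCut.exists_finset {k : ℕ} {G : SimpleGraph V}
    [DecidableRel G.Adj] {S : Set (Sym2 V)} (hS : IsRestrictedEdgeCut k G S) :
    ∃ X : Finset V, k ≤ X.card ∧ k ≤ Xᶜ.card ∧ ((G.interedges X Xᶜ).card : ℕ∞) ≤ S.encard := by
  classical
  obtain ⟨⟨-, hdis⟩, hcomp⟩ := hS
  unfold SimpleGraph.Preconnected at hdis
  push Not at hdis
  obtain ⟨u, v, huv⟩ := hdis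
  set K := G.deleteEdges S with hK
  have hmem : ∀ w, ({x | K.Reachable x w} : Finset V) =
      (K.connectedComponentMk w).supp.toFinset := by
    intro w
    ext x
    simp [SimpleGraph.ConnectedComponent.mem_supp_iff]
  have hcard : ∀ w, k ≤ ({x | K.Reachable x w} : Finset V).card := by
    intro w
    have := hcomp (K.connectedComponentMk w)
    rw [← Set.coe_toFinset (K.connectedComponentMk w).supp, ← hmem,
      Set.encard_coe_eq_coe_finsetCard] at this
    exact_mod_cast this
  refine ⟨({x | K.Reachable x u} : Finset V), hcard u, (hcard v).trans (card_le_card ?_), ?_⟩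
  · intro x hx
    simp only [mem_filter, mem_univ, true_and, mem_compl] at hx ⊢
    exact fun h => huv (h.symm.trans hx)
  · rw [← Set.encard_coe_eq_coe_finsetCard]
    refine Set.encard_le_encard_of_injOn (f := fun p : V × V => s(p.1, p.2)) ?_ ?_
    · rintro ⟨x, y⟩ h
      simp only [SetLike.mem_coe, SimpleGraph.mem_interedges_iff, mem_filter, mem_univ, true_and,
        mem_compl] at h
      obtain ⟨hx, hy, hxy⟩ := h
      by_contra hc
      have : K.Adj x y := SimpleGraph.deleteEdges_adj.2 ⟨hxy, hc⟩
      exact hy (this.symm.reachable.trans hx)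
    · rintro ⟨x, y⟩ h ⟨x', y'⟩ h' he
      simp only [SetLike.mem_coe, SimpleGraph.mem_interedges_iff, mem_filter, mem_univ, true_and,
        mem_compl] at h h'
      rcases Sym2.eq_iff.1 he with ⟨rfl, rfl⟩ | ⟨rfl, rfl⟩
      · rfl
      · exact absurd h.1 h'.2.1

/-- The boundary of `X` is a restricted edge-cut as soon as every vertex still reaches at least
`k` vertices without crossing it. -/
lemma restrictedEdgeConnectivity_le {k : ℕ} (G : SimpleGraph V) [DecidableRel G.Adj]
    {X : Finset V} {x y : V} (hx : x ∈ X) (hy : y ∉ X)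
    (h : ∀ p, ∃ T : Finset V, k ≤ T.card ∧
      ∀ q ∈ T, (G.deleteEdges (boundary G X)).Reachable p q) :
    restrictedEdgeConnectivity k G ≤ (G.interedges X Xᶜ).card := by
  refine le_trans (b := (boundary G X).encard) (sInf_le ?_) (encard_boundary_le G X)
  refine ⟨_, ⟨isEdgeCut_boundary G (mem_coe.2 hx) (by simpa using hy), fun C => ?_⟩, rfl⟩
  induction C using SimpleGraph.ConnectedComponent.ind with
  | h p =>
    obtain ⟨T, hT, hr⟩ := h p
    have hsub : (T : Set V) ⊆
        ((G.deleteEdges (boundary G X)).connectedComponentMk p).supp := by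
      intro q hq
      rw [SimpleGraph.ConnectedComponent.mem_supp_iff, SimpleGraph.ConnectedComponent.eq]
      exact (hr q hq).symm
    refine le_trans ?_ (Set.encard_le_encard hsub)
    rw [Set.encard_coe_eq_coe_finsetCard]
    exact_mod_cast hT

end Cuts

/-! ### Cuts of the strong product in terms of fibre sizes -/

section Fibres

variable {V : Type*} [Fintype V] (G : SimpleGraph V) [DecidableRel G.Adj]

/-- The number of boundary edges of a vertex set of `G ⊠ Kₙ` that has `a x` vertices in the fibre
over each vertex `x` of `G`. The truncated subtractions are harmless for `a ≤ n`. -/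
def fibreCut (n : ℕ) (a : V → ℕ) : ℕ :=
  ∑ x, (a x * (n - a x) + ∑ y ∈ G.neighborFinset x, a x * (n - a y))

lemma sum_neighborFinset_comm (g : V → V → ℕ) :
    ∑ x, ∑ y ∈ G.neighborFinset x, g x y = ∑ x, ∑ y ∈ G.neighborFinset x, g y x :=
  Finset.sum_comm' (by simp [SimpleGraph.adj_comm])

lemma card_interedges_strongProd_top [DecidableEq V] {n : ℕ}
    [DecidableRel (strongProd G (⊤ : SimpleGraph (Fin n))).Adj] (A : Finset (V × Fin n)) :
    ((strongProd G (⊤ : SimpleGraph (Fin n))).interedges A Aᶜ).card =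
      fibreCut G n fun x => #{i | (x, i) ∈ A} := by
  have hcompl : ∀ y, n - #{i | (y, i) ∈ A} = #{i | (y, i) ∉ A} := by
    intro y
    have := card_filter_add_card_filter_not (s := (univ : Finset (Fin n)))
      (fun i => (y, i) ∈ A)
    simp only [card_univ, Fintype.card_fin] at this
    omega
  have hpair : ∀ x y, #{i | (x, i) ∈ A} * #{j | (y, j) ∉ A} =
      ∑ i, ∑ j, if (x, i) ∈ A ∧ (y, j) ∉ A then 1 else 0 := by
    intro x y
    rw [card_filter, card_filter, sum_mul_sum]
    refine sum_congr rfl fun i _ => sum_congr rfl fun j _ => ?_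
    by_cases h1 : (x, i) ∈ A <;> by_cases h2 : (y, j) ∈ A <;> simp [h1, h2]
  have key : ∀ x y : V, ∀ i j : Fin n,
      ((x, i) ∈ A ∧ (y, j) ∈ Aᶜ ∧ (strongProd G (⊤ : SimpleGraph (Fin n))).Adj (x, i) (y, j)) ↔
        ((x = y ∨ G.Adj x y) ∧ ((x, i) ∈ A ∧ (y, j) ∉ A)) := by
    intro x y i j
    simp only [strongProd, mem_compl, SimpleGraph.top_adj]
    constructor
    · tauto
    · rintro ⟨rfl | h, h1, h2⟩
      · refine ⟨h1, h2, Or.inl ⟨rfl, ?_⟩⟩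
        rintro rfl
        exact h2 h1
      · by_cases hij : i = j <;> tauto
  have hinter : (strongProd G (⊤ : SimpleGraph (Fin n))).interedges A Aᶜ =
      ({p | (p.1.1 = p.2.1 ∨ G.Adj p.1.1 p.2.1) ∧ (p.1 ∈ A ∧ p.2 ∉ A)} :
        Finset ((V × Fin n) × (V × Fin n))) := by
    ext ⟨⟨x, i⟩, ⟨y, j⟩⟩
    rw [SimpleGraph.mem_interedges_iff, key]
    simp
  rw [hinter, card_filter, Fintype.sum_prod_type, Fintype.sum_prod_type]
  simp only [Fintype.sum_prod_type]
  unfold fibreCut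
  simp only [hcompl, hpair]
  refine sum_congr rfl fun x _ => ?_
  rw [sum_comm]
  have hsplit : ∀ y, (∑ i, ∑ j, if (x = y ∨ G.Adj x y) ∧ ((x, i) ∈ A ∧ (y, j) ∉ A) then 1 else 0)
      = (if x = y then ∑ i, ∑ j, (if (x, i) ∈ A ∧ (y, j) ∉ A then 1 else 0) else 0) +
        if G.Adj x y then ∑ i, ∑ j, (if (x, i) ∈ A ∧ (y, j) ∉ A then 1 else 0) else 0 := by
    intro y
    by_cases h1 : x = y
    · subst h1
      simp
    · by_cases h2 : G.Adj x y <;> simp [h1, h2]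
  simp only [hsplit, sum_add_distrib]
  congr 1
  · simp
  · rw [SimpleGraph.neighborFinset_eq_filter, sum_filter]

lemma fibreCut_compl {n : ℕ} {a : V → ℕ} (ha : ∀ x, a x ≤ n) :
    fibreCut G n (fun x => n - a x) = fibreCut G n a := by
  unfold fibreCut
  rw [sum_add_distrib, sum_add_distrib, sum_neighborFinset_comm]
  congr 1
  · exact sum_congr rfl fun x _ => by rw [Nat.sub_sub_self (ha x), mul_comm]
  · exact sum_congr rfl fun x _ => sum_congr rfl fun y _ => by
      rw [Nat.sub_sub_self (ha x), mul_comm]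

lemma card_interedges_eq_sum [DecidableEq V] (X : Finset V) :
    (G.interedges X Xᶜ).card =
      ∑ x, ∑ y ∈ G.neighborFinset x, if x ∈ X ∧ y ∉ X then 1 else 0 := by
  have : G.interedges X Xᶜ = ({p | G.Adj p.1 p.2 ∧ (p.1 ∈ X ∧ p.2 ∉ X)} : Finset (V × V)) := by
    ext ⟨x, y⟩
    simp only [SimpleGraph.mem_interedges_iff, mem_compl, mem_filter, mem_univ, true_and]
    tauto
  rw [this, card_filter, Fintype.sum_prod_type]
  refine sum_congr rfl fun x _ => ?_
  rw [SimpleGraph.neighborFinset_eq_filter, sum_filter]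
  refine sum_congr rfl fun y _ => ?_
  by_cases h : G.Adj x y <;> simp [h]

variable {G}

/-- The total variation of `a` along the edges is the sum of the boundary sizes of the level sets
`{x | t < a x}`; those with `t < a w` are nonempty and proper if `a` vanishes somewhere. -/
lemma IsMaximallyEdgeConnected.minDegree_mul_le [DecidableEq V] (hG : IsMaximallyEdgeConnected G) {a : V → ℕ}
    {z : V} (hz : a z = 0) (w : V) :
    a w * G.minDegree ≤ ∑ x, ∑ y ∈ G.neighborFinset x, (a x - a y) := by
  have hlevel : ∀ t ∈ range (a w), G.minDegree ≤
      ∑ x, ∑ y ∈ G.neighborFinset x, if a y ≤ t ∧ t < a x then 1 else 0 := by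
    intro t ht
    have := hG.minDegree_le_card_interedges (X := ({x | t < a x} : Finset V)) (x := w) (y := z)
      (by simpa using ht) (by simp [hz])
    rw [card_interedges_eq_sum] at this
    refine this.trans_eq (sum_congr rfl fun x _ => sum_congr rfl fun y _ => ?_)
    simp [and_comm]
  calc a w * G.minDegree = ∑ t ∈ range (a w), G.minDegree := by simp
    _ ≤ _ := sum_le_sum hlevel
    _ = ∑ x, ∑ y ∈ G.neighborFinset x, ∑ t ∈ range (a w), if a y ≤ t ∧ t < a x then 1 else 0 := by
      rw [sum_comm]
      exact sum_congr rfl fun x _ => sum_comm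
    _ ≤ _ := by
      refine sum_le_sum fun x _ => sum_le_sum fun y _ => ?_
      rw [← card_filter, ← Nat.card_Ico]
      refine card_le_card fun t ht => ?_
      simpa using (mem_filter.1 ht).2

lemma IsMaximallyEdgeConnected.mul_le_fibreCut [DecidableEq V] (hG : IsMaximallyEdgeConnected G) {n : ℕ}
    {a : V → ℕ} (ha : ∀ x, a x ≤ n) {z : V} (hz : a z = 0) (w : V) :
    a w * (n - a w) + n * (a w * G.minDegree) ≤ fibreCut G n a := by
  unfold fibreCut
  rw [sum_add_distrib]
  refine add_le_add (single_le_sum (f := fun x => a x * (n - a x)) (fun _ _ => Nat.zero_le _)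
    (mem_univ w)) ((Nat.mul_le_mul_left n (hG.minDegree_mul_le hz w)).trans ?_)
  -- Both double sums run over ordered pairs; compare them after adding the two orientations.
  have h1 := sum_neighborFinset_comm G fun x y => a x * (n - a y)
  have h2 := sum_neighborFinset_comm G fun x y => a x - a y
  have h3 : n * ((∑ x, ∑ y ∈ G.neighborFinset x, (a x - a y)) +
      ∑ x, ∑ y ∈ G.neighborFinset x, (a y - a x)) ≤
      (∑ x, ∑ y ∈ G.neighborFinset x, a x * (n - a y)) +
      ∑ x, ∑ y ∈ G.neighborFinset x, a y * (n - a x) := by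
    simp only [← sum_add_distrib, mul_sum]
    refine sum_le_sum fun x _ => sum_le_sum fun y _ => ?_
    obtain ⟨b, hb⟩ := Nat.exists_eq_add_of_le (ha x)
    obtain ⟨c, hc⟩ := Nat.exists_eq_add_of_le (ha y)
    rw [show n - a x = b by omega, show n - a y = c by omega]
    rcases le_total (a x) (a y) with h | h
    · rw [Nat.sub_eq_zero_of_le h, zero_add]
      zify [h]
      have : (n : ℤ) = a x + b := by exact_mod_cast hb
      have : (n : ℤ) = a y + c := by exact_mod_cast hc
      have : (0 : ℤ) ≤ a x * c := by positivity
      nlinarith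
    · rw [Nat.sub_eq_zero_of_le h, add_zero]
      zify [h]
      have : (n : ℤ) = a x + b := by exact_mod_cast hb
      have : (n : ℤ) = a y + c := by exact_mod_cast hc
      have : (0 : ℤ) ≤ a y * b := by positivity
      nlinarith
  rw [← h1, ← h2, ← two_mul, ← two_mul] at h3
  linarith

variable (G)

/-- The bound `s * (N - s) ≤ fibreCut G n a` for `s = ∑ x, a x` and `N = n * (1 + δ)`, free of
subtraction: a closed neighbourhood in `G ⊠ Kₙ` has at least `N` elements, at most `s` of which lie
in a given set of size `s`. -/
lemma sum_mul_le_fibreCut_add [DecidableEq V] (n : ℕ) (a : V → ℕ) :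
    (∑ x, a x) * (n * (1 + G.minDegree)) ≤ fibreCut G n a + (∑ x, a x) * ∑ x, a x := by
  unfold fibreCut
  rw [sum_mul, sum_mul, ← sum_add_distrib]
  refine sum_le_sum fun x _ => ?_
  rw [← mul_sum, ← mul_add, ← mul_add]
  refine Nat.mul_le_mul_left _ ?_
  have h1 : a x + ∑ y ∈ G.neighborFinset x, a y ≤ ∑ y, a y := by
    rw [← sum_insert (f := a) (G.notMem_neighborFinset_self x)]
    exact sum_le_sum_of_subset (subset_univ _)
  have h2 : n * G.minDegree ≤ ∑ y ∈ G.neighborFinset x, (n - a y + a y) := by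
    calc n * G.minDegree ≤ n * G.degree x := Nat.mul_le_mul_left _ (G.minDegree_le_degree x)
      _ = ∑ y ∈ G.neighborFinset x, n := by simp [mul_comm]
      _ ≤ _ := sum_le_sum fun y _ => by omega
  rw [sum_add_distrib] at h2
  have h3 : n ≤ n - a x + a x := by omega
  linarith

/-- If every fibre is met at most `c` times, each vertex of the set is joined to at least `n - c`
vertices outside it in its own fibre and in each neighbouring one. -/
lemma sum_mul_le_fibreCut (n c : ℕ) {a : V → ℕ} (hc : ∀ x, a x ≤ c) :
    (∑ x, a x) * ((n - c) * (1 + G.minDegree)) ≤ fibreCut G n a := by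
  unfold fibreCut
  rw [sum_mul]
  refine sum_le_sum fun x _ => ?_
  rw [← mul_sum, ← mul_add, mul_add, mul_one]
  refine Nat.mul_le_mul_left _ (add_le_add (Nat.sub_le_sub_left (hc x) n) ?_)
  calc (n - c) * G.minDegree ≤ (n - c) * G.degree x :=
        Nat.mul_le_mul_left _ (G.minDegree_le_degree x)
    _ = ∑ y ∈ G.neighborFinset x, (n - c) := by simp [mul_comm]
    _ ≤ _ := sum_le_sum fun y _ => Nat.sub_le_sub_left (hc y) n

lemma sum_neighborFinset_const (c : ℕ) :
    ∑ x, ∑ _y ∈ G.neighborFinset x, c = 2 * #G.edgeFinset * c := by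
  rw [← G.sum_degrees_eq_twice_card_edges, sum_mul]
  simp

/-- If every fibre is met but none is full, each fibre and each edge of `G` contributes at least
as much as it does for a single copy of `G`, where `a = 1`. -/
lemma le_fibreCut_of_pos_of_lt {n : ℕ} {a : V → ℕ} (h0 : ∀ x, 0 < a x) (hn : ∀ x, a x < n) :
    (n - 1) * (Fintype.card V + 2 * #G.edgeFinset) ≤ fibreCut G n a := by
  obtain ⟨k, rfl | rfl⟩ : ∃ k, n = 0 ∨ n = k + 1 := ⟨n - 1, by omega⟩
  · simp
  unfold fibreCut
  rw [sum_add_distrib, mul_add, Nat.add_sub_cancel]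
  refine add_le_add ?_ ?_
  · calc k * Fintype.card V = ∑ x : V, k := by simp [mul_comm]
      _ ≤ _ := by
        refine sum_le_sum fun x _ => ?_
        obtain ⟨p, hp⟩ := Nat.exists_eq_add_of_lt (h0 x)
        obtain ⟨q, hq⟩ := Nat.exists_eq_add_of_lt (hn x)
        rw [show k + 1 - a x = q + 1 by omega, show k = p + q + 1 by omega, hp]
        nlinarith [Nat.zero_le (p * q)]
  · have h1 := sum_neighborFinset_comm G fun x y => a x * (k + 1 - a y)
    have h3 : (∑ x, ∑ _y ∈ G.neighborFinset x, 2 * k) ≤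
        (∑ x, ∑ y ∈ G.neighborFinset x, a x * (k + 1 - a y)) +
        ∑ x, ∑ y ∈ G.neighborFinset x, a y * (k + 1 - a x) := by
      simp only [← sum_add_distrib]
      refine sum_le_sum fun x _ => sum_le_sum fun y _ => ?_
      obtain ⟨p, hp⟩ := Nat.exists_eq_add_of_lt (h0 x)
      obtain ⟨q, hq⟩ := Nat.exists_eq_add_of_lt (hn x)
      obtain ⟨r, hr⟩ := Nat.exists_eq_add_of_lt (h0 y)
      obtain ⟨s, hs⟩ := Nat.exists_eq_add_of_lt (hn y)
      rw [show k + 1 - a x = q + 1 by omega, show k + 1 - a y = s + 1 by omega, hp, hr]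
      have e1 : k = p + q + 1 := by omega
      have e2 : k = r + s + 1 := by omega
      nlinarith [Nat.zero_le (p * s), Nat.zero_le (r * q)]
    rw [← h1, ← two_mul, sum_neighborFinset_const] at h3
    linarith

variable {G}

/-- The cut bound when some fibre is not met. A fibre met in at least three vertices is handled by
the level sets; otherwise all fibres are met in at most two vertices, and counting neighbours
suffices. -/
lemma IsMaximallyEdgeConnected.le_fibreCut_of_eq_zero [DecidableEq V] (hG : IsMaximallyEdgeConnected G)
    (hδ : 0 < G.minDegree) {n : ℕ} (hn : 4 ≤ n) {a : V → ℕ} (ha : ∀ x, a x ≤ n)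
    (hs : 3 ≤ ∑ x, a x) {z : V} (hz : a z = 0) :
    3 * n * G.minDegree + 3 * n - 9 ≤ fibreCut G n a := by
  set d := G.minDegree with hd
  rw [tsub_le_iff_right]
  have hnd : n ≤ n * d := Nat.le_mul_of_pos_right n hδ
  by_cases hw : ∃ w, 3 ≤ a w
  · obtain ⟨w, hw⟩ := hw
    have h := hG.mul_le_fibreCut ha hz w
    rw [← hd] at h
    obtain ⟨b, hb⟩ := Nat.exists_eq_add_of_le (ha w)
    obtain ⟨c, hc⟩ := Nat.exists_eq_add_of_le hw
    rw [show n - a w = b by omega] at h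
    -- The bound from the level sets is concave in `a w`, so its excess over `a w = 3` factors.
    have : c * (c + 6) ≤ c * (n * d + n) := Nat.mul_le_mul_left _ (by omega)
    rw [hc] at h hb
    nlinarith
  · push Not at hw
    have h1 := sum_mul_le_fibreCut_add G n a
    have h2 := sum_mul_le_fibreCut G n 2 (a := a) fun x => by have := hw x; omega
    rw [← hd] at h1 h2
    generalize (∑ x, a x) = s at h1 h2 hs
    obtain ⟨k, rfl⟩ := Nat.exists_eq_add_of_le hn
    rw [show 4 + k - 2 = 2 + k by omega] at h2
    rcases le_or_gt s 5 with h5 | h5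
    · interval_cases s <;> nlinarith
    · have := Nat.mul_le_mul_right ((2 + k) * (1 + d)) (show 6 ≤ s by omega)
      nlinarith

lemma IsMaximallyEdgeConnected.le_fibreCut [DecidableEq V] (hG : IsMaximallyEdgeConnected G)
    (hδ : 0 < G.minDegree) {n : ℕ} (hn : 4 ≤ n) {a : V → ℕ} (ha : ∀ x, a x ≤ n)
    (hs : 3 ≤ ∑ x, a x) (hs' : 3 ≤ ∑ x, (n - a x)) :
    min ((n - 1) * (Fintype.card V + 2 * #G.edgeFinset)) (3 * n * G.minDegree + 3 * n - 9) ≤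
      fibreCut G n a := by
  by_cases h0 : ∃ z, a z = 0
  · obtain ⟨z, hz⟩ := h0
    exact (min_le_right _ _).trans (hG.le_fibreCut_of_eq_zero hδ hn ha hs hz)
  by_cases hfull : ∃ z, a z = n
  · obtain ⟨z, hz⟩ := hfull
    rw [← fibreCut_compl G ha]
    exact (min_le_right _ _).trans (hG.le_fibreCut_of_eq_zero hδ hn (fun x => Nat.sub_le _ _) hs'
      (z := z) (by simp [hz]))
  · push Not at h0 hfull
    exact (min_le_left _ _).trans (le_fibreCut_of_pos_of_lt G
      (fun x => Nat.pos_of_ne_zero (h0 x)) fun x => lt_of_le_of_ne (ha x) (hfull x))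

end Fibres

/-! ### Bounds for the restricted edge-connectivity -/

section Product

variable {V : Type*} [Fintype V] [DecidableEq V] {G : SimpleGraph V} [DecidableRel G.Adj] {n : ℕ}

lemma IsMaximallyEdgeConnected.le_restrictedEdgeConnectivity (hG : IsMaximallyEdgeConnected G)
    (hδ : 0 < G.minDegree) (hn : 4 ≤ n) :
    ((min ((n - 1) * (Fintype.card V + 2 * #G.edgeFinset))
      (3 * n * G.minDegree + 3 * n - 9) : ℕ) : ℕ∞) ≤
      restrictedEdgeConnectivity 3 (strongProd G (⊤ : SimpleGraph (Fin n))) := by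
  classical
  refine le_sInf ?_
  rintro _ ⟨S, hS, rfl⟩
  obtain ⟨A, h1, h2, h3⟩ := hS.exists_finset
  refine le_trans ?_ h3
  rw [card_interedges_strongProd_top]
  have hfib : ∀ B : Finset (V × Fin n), ∑ x, #{i | (x, i) ∈ B} = #B := by
    intro B
    simp only [card_filter]
    rw [← Fintype.sum_prod_type' (f := fun x i => if (x, i) ∈ B then 1 else 0)]
    simp
  have hle : ∀ x, #{i | (x, i) ∈ A} ≤ n := fun x => (card_le_univ _).trans_eq (by simp)
  refine Nat.cast_le.2 (hG.le_fibreCut hδ hn hle (h1.trans_eq (hfib A).symm) ?_)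
  refine (h2.trans_eq (hfib Aᶜ).symm).trans_eq (sum_congr rfl fun x _ => ?_)
  have := card_filter_add_card_filter_not (s := (univ : Finset (Fin n))) (fun i => (x, i) ∈ A)
  simp only [card_univ, Fintype.card_fin] at this
  simp only [mem_compl]
  omega

lemma strongProd_top_adj {V : Type*} {G : SimpleGraph V} {x y : V} {i j : Fin n}
    (h : x = y ∨ G.Adj x y) (hne : (x, i) ≠ (y, j)) :
    (strongProd G (⊤ : SimpleGraph (Fin n))).Adj (x, i) (y, j) := by
  simp only [strongProd, SimpleGraph.top_adj]
  rcases h with rfl | h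
  · exact Or.inl ⟨rfl, fun h => hne (by rw [h])⟩
  · by_cases hij : i = j <;> tauto

lemma strongProd_top_reachable {V : Type*} {G : SimpleGraph V} {A : Set (V × Fin n)} {x y : V}
    {i j : Fin n} (h : x = y ∨ G.Adj x y) (hA : (x, i) ∈ A ↔ (y, j) ∈ A) :
    ((strongProd G (⊤ : SimpleGraph (Fin n))).deleteEdges
      (boundary (strongProd G ⊤) A)).Reachable (x, i) (y, j) := by
  by_cases hne : (x, i) = (y, j)
  · rw [hne]
  · exact ((boundary_adj_iff _ _).2 ⟨strongProd_top_adj h hne, hA⟩).reachable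

/-- The cut around a whole fibre `{v} × Kₙ`. -/
lemma restrictedEdgeConnectivity_le_of_fibre {k : ℕ} (hk : k ≤ n) (h0 : 0 < n)
    (hV : 1 < Fintype.card V) (v : V) :
    restrictedEdgeConnectivity k (strongProd G (⊤ : SimpleGraph (Fin n))) ≤
      (n ^ 2 * G.degree v : ℕ) := by
  classical
  obtain ⟨w, hw⟩ := Fintype.exists_ne_of_one_lt_card hV v
  let A : Finset (V × Fin n) := {v} ×ˢ univ
  refine (restrictedEdgeConnectivity_le _ (X := A) (x := (v, ⟨0, h0⟩)) (y := (w, ⟨0, h0⟩))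
    (by simp [A]) (by simp [A, hw.symm]) ?_).trans ?_
  · rintro ⟨x, i⟩
    refine ⟨{x} ×ˢ univ, by simpa using hk, ?_⟩
    rintro ⟨y, j⟩ hy
    obtain rfl : x = y := by simpa using hy
    exact strongProd_top_reachable (Or.inl rfl) (by simp [A])
  · rw [card_interedges_strongProd_top]
    refine Nat.cast_le.2 (le_of_eq ?_)
    have ha : ∀ x, #{i | (x, i) ∈ A} = if x = v then n else 0 := by
      intro x
      by_cases hx : x = v
      · simp [A, hx]
      · simp [A, hx, Ne.symm hx]
    simp only [ha]
    unfold fibreCut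
    rw [sum_eq_single v]
    · simp only [if_true, Nat.sub_self, mul_zero, zero_add]
      rw [sum_congr rfl (g := fun _ => n * n)]
      · simp; ring
      · intro y hy
        have : y ≠ v := by
          rintro rfl
          simp at hy
        simp [this]
    · intro x _ hx
      simp [hx]
    · simp

/-- The cut around a copy `V × {i}` of `G`. -/
lemma restrictedEdgeConnectivity_le_of_layer {k : ℕ} (hk : k ≤ Fintype.card V) (hn : 2 ≤ n)
    [Nonempty V] (hG : G.Preconnected) :
    restrictedEdgeConnectivity k (strongProd G (⊤ : SimpleGraph (Fin n))) ≤
      ((n - 1) * (Fintype.card V + 2 * #G.edgeFinset) : ℕ) := by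
  classical
  obtain ⟨v⟩ := ‹Nonempty V›
  let i₀ : Fin n := ⟨0, by omega⟩
  let A : Finset (V × Fin n) := univ ×ˢ {i₀}
  refine (restrictedEdgeConnectivity_le _ (X := A) (x := (v, i₀)) (y := (v, ⟨1, by omega⟩))
    (by simp [A]) (by simp [A, i₀]) ?_).trans ?_
  · rintro ⟨x, i⟩
    refine ⟨univ ×ˢ {i}, by simpa using hk, ?_⟩
    rintro ⟨y, j⟩ hy
    obtain rfl : i = j := by simpa using hy
    obtain ⟨p⟩ := hG x y
    induction p with
    | nil => rfl
    | cons h _ ih =>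
      exact (strongProd_top_reachable (Or.inr h) (by simp [A])).trans (ih (by simp))
  · rw [card_interedges_strongProd_top]
    refine Nat.cast_le.2 (le_of_eq ?_)
    have ha : ∀ x, #{i | (x, i) ∈ A} = 1 := by
      intro x
      simp [A, filter_eq]
    simp only [ha]
    unfold fibreCut
    rw [sum_add_distrib, sum_neighborFinset_const]
    simp
    ring

/-- The cut around three vertices of one fibre. -/
lemma restrictedEdgeConnectivity_three_le (hn : 4 ≤ n) (v : V) (hv : 0 < G.degree v) :
    restrictedEdgeConnectivity 3 (strongProd G (⊤ : SimpleGraph (Fin n))) ≤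
      (3 * n * G.degree v + 3 * n - 9 : ℕ) := by
  classical
  obtain ⟨w, hw⟩ := (G.degree_pos_iff_exists_adj v).1 hv
  obtain ⟨T, -, hT⟩ := exists_subset_card_eq (s := (univ : Finset (Fin n))) (n := 3)
    (by simp; omega)
  obtain ⟨i₀, hi₀⟩ : T.Nonempty := card_pos.1 (by omega)
  let A : Finset (V × Fin n) := {v} ×ˢ T
  refine (restrictedEdgeConnectivity_le _ (X := A) (x := (v, i₀)) (y := (w, i₀))
    (by simp [A, hi₀]) (by simp [A, hw.ne]) ?_).trans ?_
  · rintro ⟨x, i⟩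
    by_cases hx : x = v
    · subst hx
      by_cases hi : i ∈ T
      · refine ⟨A, by simp [A, hT], ?_⟩
        rintro ⟨y, j⟩ hy
        obtain ⟨hj, rfl⟩ : j ∈ T ∧ x = y := by simpa [A] using hy
        exact strongProd_top_reachable (Or.inl rfl) (by simp [A, hi, hj])
      · refine ⟨{w} ×ˢ univ, by simp; omega, ?_⟩
        rintro ⟨y, j⟩ hy
        obtain rfl : w = y := by simpa using hy
        exact strongProd_top_reachable (Or.inr hw) (by simp [A, hi, hw.ne])
    · refine ⟨{x} ×ˢ univ, by simp; omega, ?_⟩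
      rintro ⟨y, j⟩ hy
      obtain rfl : x = y := by simpa using hy
      exact strongProd_top_reachable (Or.inl rfl) (by simp [A, Ne.symm hx])
  · rw [card_interedges_strongProd_top]
    refine Nat.cast_le.2 (le_of_eq ?_)
    have ha : ∀ x, #{i | (x, i) ∈ A} = if x = v then 3 else 0 := by
      intro x
      by_cases hx : x = v
      · simp [A, hx, hT]
      · simp [A, hx, Ne.symm hx]
    simp only [ha]
    unfold fibreCut
    rw [sum_eq_single v]
    · rw [sum_congr rfl (g := fun _ => 3 * n)]
      · simp only [if_true, sum_const, smul_eq_mul, SimpleGraph.card_neighborFinset_eq_degree]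
        rw [mul_comm (G.degree v)]
        omega
      · intro y hy
        have : y ≠ v := by
          rintro rfl
          simp at hy
        simp [this]
    · intro x _ hx
      simp [hx]
    · simp

end Product

end RestrictedEdgeConnectivity

open RestrictedEdgeConnectivity in
theorem theorem3p2 {V : Type*} [Fintype V] [DecidableEq V] (G : SimpleGraph V)
    [DecidableRel G.Adj] (hG : RestrictedEdgeConnectivity.IsMaximallyEdgeConnected G)
    (m n : ℕ) (hm : Fintype.card V = m) (hm3 : 3 ≤ m) (hn : 4 ≤ n) :
    RestrictedEdgeConnectivity.restrictedEdgeConnectivity 3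
        (RestrictedEdgeConnectivity.strongProd G (⊤ : SimpleGraph (Fin n))) =
      ((min (n ^ 2 * G.minDegree)
        (min ((n - 1) * (m + 2 * G.edgeFinset.card))
          (3 * n * G.minDegree + 3 * n - 9)) : ℕ) : ℕ∞) := by
  subst hm
  have : Nonempty V := Fintype.card_pos_iff.1 (by omega)
  obtain ⟨v, hv⟩ := G.exists_minimal_degree_vertex
  have h1 := restrictedEdgeConnectivity_le_of_fibre (G := G) (k := 3) (n := n) (by omega)
    (by omega) (by omega) v
  rw [← hv] at h1
  rcases Nat.eq_zero_or_pos G.minDegree with hδ | hδ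
  · rw [hδ] at h1 ⊢
    simpa using h1
  apply le_antisymm
  · rw [(Nat.mono_cast (α := ℕ∞)).map_min, (Nat.mono_cast (α := ℕ∞)).map_min]
    refine le_min h1 (le_min ?_ ?_)
    · exact restrictedEdgeConnectivity_le_of_layer hm3 (by omega) (hG.preconnected hδ)
    · have := restrictedEdgeConnectivity_three_le hn v (hv ▸ hδ)
      rwa [← hv] at this
  · exact (Nat.cast_le.2 (min_le_right _ _)).trans (hG.le_restrictedEdgeConnectivity hδ hn)
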